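/- Let $M$ be a compact (boundaryless) $C^\infty$ manifold with a Riemannian metric, let $f:M\to M$ be a $C^1$ local diffeomorphism, and let $\Lambda\subseteq M$ be a compact set with $f(\Lambda)\subseteq\Lambda$. Suppose that $T_\Lambda M=E\oplus F$ is a continuous splitting which is $Df$-invariant, i.e. $Df(x)E(x)=E(f(x))$ and $Df(x)F(x)=F(f(x))$ for all $x\in\Lambda$. Let $\mathcal M_f(\Lambda)$ be the set of $f$-invariant Borel probability measures supported on $\Lambda$, and for $x\in M$ let $V_f(x)$ be the set of all weak$^*$ accumulation points of the sequence $\frac1N\sum_{j=0}^{N-1}\delta_{f^j(x)}$, $N\ge 1$. Let $y\in\Lambda$ satisfy $\mathcal M_f(\Lambda)=V_f(y)$, and suppose that $y$ is NUH with respect to $E\oplus F$: there are $\eta>0$, $L\in\mathbb N$ and a Riemannian metric $\|\cdot\|$ on $M$ such that $$\limsup_{n\to\infty}\frac1n\sum_{j=0}^{n-1}\log\bigl\|Df^L(f^j(y))|_{E(f^j(y))}\bigr\|\le-\eta,\qquad \limsup_{n\to\infty}\frac1n\sum_{j=0}^{n-1}\log\bigl\|[Df^L(f^j(y))|_{F(f^j(y))}]^{-1}\bigr\|\le-\eta$$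 (with $\log 0=-\infty$, so that a condition on a zero subbundle holds trivially). Then $\Lambda$ is uniformly hyperbolic with splitting $T_\Lambda M=E\oplus F$: there are constants $C>0$ and $0<\lambda<1$ such that for all $n\in\mathbb N$ and all $x\in\Lambda$, $$\bigl\|Df^n(x)|_{E(x)}\bigr\|\le C\lambda^n\quad\text{and}\quad \bigl\|[Df^n(x)|_{F(x)}]^{-1}\bigr\|\le C\lambda^n ,$$ the norms being those of the given Riemannian metric on $M$. -/

import Mathlib

open Set Filter Topology MeasureTheory
open scoped Manifold ContDiff ENNReal

noncomputable section

namespace HypSplit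

section Measures

variable {M : Type*} [MeasurableSpace M]

/-- The time average `1/(N+1) * ∑_{j=0}^{N} δ_{f^j x}` along the forward orbit of `x`
(averages over at least one point, so that the result is a probability measure). -/
def timeAverage (f : M → M) (x : M) (N : ℕ) : ProbabilityMeasure M :=
  ⟨((N + 1 : ℕ) : ℝ≥0∞)⁻¹ • ∑ j ∈ Finset.range (N + 1), Measure.dirac (f^[j] x), ⟨by
    rw [Measure.smul_apply, Measure.finsetSum_apply]
    simp only [measure_univ, Finset.sum_const, Finset.card_range, nsmul_eq_mul, mul_one,
      smul_eq_mul]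
    exact ENNReal.inv_mul_cancel (by exact_mod_cast Nat.succ_ne_zero N)
      (ENNReal.natCast_ne_top _)⟩⟩

/-- `V_f(x)`: the accumulation points, in the weak* topology, of the sequence of time averages
along the forward orbit of `x`. -/
def accumulationMeasures [TopologicalSpace M] [OpensMeasurableSpace M] (f : M → M) (x : M) :
    Set (ProbabilityMeasure M) :=
  {μ | MapClusterPt μ atTop (timeAverage f x)}

/-- `M_f(Λ)`: the `f`-invariant Borel probability measures supported on the (closed) set `Λ`. -/
def invariantMeasures (f : M → M) (Λ : Set M) : Set (ProbabilityMeasure M) :=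
  {μ | MeasurePreserving f (μ : Measure M) (μ : Measure M) ∧ (μ : Measure M) Λᶜ = 0}

end Measures

variable {d : ℕ} {M : Type*} [TopologicalSpace M] [ChartedSpace (EuclideanSpace ℝ (Fin d)) M]

section Manifold

variable [IsManifold (𝓡 d) ∞ M]

variable (d M) in
/-- (Continuous) Riemannian metrics on the manifold `M`. -/
abbrev Metric :=
  Bundle.ContinuousRiemannianMetric (EuclideanSpace ℝ (Fin d)) (TangentSpace (𝓡 d) : M → Type _)

/-- The length of a tangent vector with respect to a Riemannian metric. -/
def Metric.length (g : Metric d M) (x : M) (v : TangentSpace (𝓡 d) x) : ℝ≥0∞ :=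
  ENNReal.ofReal (Real.sqrt (g.inner x v v))

/-- `‖Df^n(x)|_S‖`: the operator norm of the derivative of `f^n` at `x`, restricted to a
subspace `S` of `T_x M`. -/
def normOn (g : Metric d M) (f : M → M) (n : ℕ) (x : M)
    (S : Submodule ℝ (TangentSpace (𝓡 d) x)) : ℝ≥0∞ :=
  ⨆ v ∈ S, ⨆ _ : g.length x v ≤ 1, g.length (f^[n] x) (mfderiv (𝓡 d) (𝓡 d) f^[n] x v)

/-- `‖[Df^n(x)|_S]⁻¹‖`: the operator norm of the inverse of the (injective) linear map
`Df^n(x) : S → Df^n(x) S`. Here a vector `w` of the image is written `w = Df^n(x) v` with `v ∈ S`,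
so that its image under the inverse is `v`. -/
def invNormOn (g : Metric d M) (f : M → M) (n : ℕ) (x : M)
    (S : Submodule ℝ (TangentSpace (𝓡 d) x)) : ℝ≥0∞ :=
  ⨆ v ∈ S, ⨆ _ : g.length (f^[n] x) (mfderiv (𝓡 d) (𝓡 d) f^[n] x v) ≤ 1, g.length x v

end Manifold

/-- `T_A M = E ⊕ F` is a `Df`-invariant splitting over the set `A`. -/
structure IsInvariantSplitting (f : M → M) (A : Set M)
    (E F : ∀ x : M, Submodule ℝ (TangentSpace (𝓡 d) x)) : Prop where
  isCompl : ∀ x ∈ A, IsCompl (E x) (F x)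
  map_left : ∀ x ∈ A, (E x).map (mfderiv (𝓡 d) (𝓡 d) f x).toLinearMap = E (f x)
  map_right : ∀ x ∈ A, (F x).map (mfderiv (𝓡 d) (𝓡 d) f x).toLinearMap = F (f x)

variable [IsManifold (𝓡 d) ∞ M]

/-- `S` is a continuous subbundle of the tangent bundle over `A`: near every point of `A` it is
spanned by a continuous frame. -/
def IsContinuousSubbundle (A : Set M) (S : ∀ x : M, Submodule ℝ (TangentSpace (𝓡 d) x)) : Prop :=
  ∀ x₀ ∈ A, ∃ U : Set M, IsOpen U ∧ x₀ ∈ U ∧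
    ∃ (k : ℕ) (s : Fin k → ∀ x : M, TangentSpace (𝓡 d) x),
      (∀ i, ContinuousOn (fun x => (⟨x, s i x⟩ : TangentBundle (𝓡 d) M)) (A ∩ U)) ∧
      ∀ x ∈ A ∩ U, LinearIndependent ℝ (fun i => s i x) ∧
        Submodule.span ℝ (Set.range fun i => s i x) = S x

/-- `T_A M = E ⊕ F` is a continuous `Df`-invariant splitting over `A`. -/
structure IsContinuousInvariantSplitting (f : M → M) (A : Set M)
    (E F : ∀ x : M, Submodule ℝ (TangentSpace (𝓡 d) x)) : Prop
    extends IsInvariantSplitting f A E F where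
  continuous_left : IsContinuousSubbundle A E
  continuous_right : IsContinuousSubbundle A F

/-- `Λ` is uniformly hyperbolic with splitting `T_Λ M = E ⊕ F`, the rates being measured in the
Riemannian metric `g`: the splitting is continuous and `Df`-invariant, `E` is uniformly contracted
and `F` is uniformly expanded. -/
def IsUniformlyHyperbolicWith (g : Metric d M) (f : M → M) (Λ : Set M)
    (E F : ∀ x : M, Submodule ℝ (TangentSpace (𝓡 d) x)) : Prop :=
  IsContinuousInvariantSplitting f Λ E F ∧
    ∃ C lam : ℝ, 0 < C ∧ 0 < lam ∧ lam < 1 ∧ ∀ n : ℕ, ∀ x ∈ Λ,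
      normOn g f n x (E x) ≤ ENNReal.ofReal (C * lam ^ n) ∧
      invNormOn g f n x (F x) ≤ ENNReal.ofReal (C * lam ^ n)

/-- `y` is a NUH point of `f` with respect to the splitting `E ⊕ F` over its forward orbit.
Logarithms take values in the extended reals, with `log 0 = -∞`; this value occurs exactly when
the subspace in question is zero. -/
def IsNUH (f : M → M) (y : M) (E F : ∀ x : M, Submodule ℝ (TangentSpace (𝓡 d) x)) : Prop :=
  IsInvariantSplitting f (Set.range fun j : ℕ => f^[j] y) E F ∧
    ∃ (η : ℝ) (L : ℕ) (g : Metric d M), 0 < η ∧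
      limsup (fun n : ℕ => (((n : ℝ)⁻¹ : ℝ) : EReal) *
        ∑ j ∈ Finset.range n, ENNReal.log (normOn g f L (f^[j] y) (E (f^[j] y)))) atTop
          ≤ ((-η : ℝ) : EReal) ∧
      limsup (fun n : ℕ => (((n : ℝ)⁻¹ : ℝ) : EReal) *
        ∑ j ∈ Finset.range n, ENNReal.log (invNormOn g f L (f^[j] y) (F (f^[j] y)))) atTop
          ≤ ((-η : ℝ) : EReal)

end HypSplit

end

/-! The numbers ‖Df^n(x)|E‖ form a submultiplicative cocycle over `f`, and so do ‖[Df^n(x)|F]⁻¹‖.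
Both are suprema, over a fibre, of ratios of two lengths of iterated images of a vector, so one
argument (`exists_relNorm_le_geometric`) serves both bundles. Write `a n` for such a cocycle. On
`Λ`, log `a L` is dominated by a continuous function φ whose averages along the orbit of `y` are
eventually at most -η/2 (`exists_log_relNorm_majorant`).

Every invariant measure on `Λ` is a limit of time averages of `y`, hence gives φ an integral at most
-η/2. If arbitrarily long orbit pieces in `Λ` had φ-average above -η/4, a limit of their time
averages would be an invariant measure with integral at least -η/4, a contradiction. So the Birkhoff
averages are uniformly negative on `Λ` (`eventually_forall_birkhoffSum_le`).

Since φ controls only steps of length `L`, the orbit is split into residue classes mod `L`. Some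
class carries at most the mean share of the sum, and following it makes a later term of the cocycle
at most 1/2 everywhere on `Λ` (`exists_cocycle_le_half`). Iteration gives geometric decay, and
changing the metric over the compact set `Λ` costs only a constant. -/

namespace HypSplit

/-! ### Time averages, invariant measures and uniform Birkhoff bounds -/

section Averages

variable {X : Type*} [TopologicalSpace X]
  [MeasurableSpace X] [BorelSpace X]

theorem integral_timeAverage [T2Space X] (f : X → X) (x : X) (N : ℕ) (h : X → ℝ) :
    ∫ z, h z ∂(timeAverage f x N : Measure X)
      = ((N + 1 : ℕ) : ℝ)⁻¹ * ∑ j ∈ Finset.range (N + 1), h (f^[j] x) := by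
  have hc : (timeAverage f x N : Measure X) = ((N + 1 : ℕ) : ℝ≥0∞)⁻¹ •
      ∑ j ∈ Finset.range (N + 1), Measure.dirac (f^[j] x) := rfl
  rw [hc, integral_smul_measure, integral_finsetSum_measure]
  · simp only [integral_dirac, smul_eq_mul, ENNReal.toReal_inv, ENNReal.toReal_natCast]
  · intro j _
    exact integrable_dirac (by simp)

theorem timeAverage_apply_eq_one (f : X → X) {A : Set X} (hA : IsClosed A) (hinv : MapsTo f A A)
    {x : X} (hx : x ∈ A) (N : ℕ) : (timeAverage f x N : Measure X) A = 1 := by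
  have hc : (timeAverage f x N : Measure X) = ((N + 1 : ℕ) : ℝ≥0∞)⁻¹ •
      ∑ j ∈ Finset.range (N + 1), Measure.dirac (f^[j] x) := rfl
  rw [hc, Measure.smul_apply, Measure.finsetSum_apply]
  have : ∀ j ∈ Finset.range (N + 1), Measure.dirac (f^[j] x) A = 1 := fun j _ => by
    rw [Measure.dirac_apply' _ hA.measurableSet]
    exact Set.indicator_of_mem (hinv.iterate j hx) 1
  rw [Finset.sum_congr rfl this]
  simp only [Finset.sum_const, Finset.card_range, nsmul_eq_mul, mul_one, smul_eq_mul]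
  exact ENNReal.inv_mul_cancel (by exact_mod_cast Nat.succ_ne_zero N) (ENNReal.natCast_ne_top _)

/-- The sum telescopes, so the defect of invariance is a boundary term of order 1/N. -/
theorem integral_comp_sub_timeAverage [T2Space X] (f : X → X) (x : X) (N : ℕ) (h : X → ℝ) :
    (∫ z, h (f z) ∂(timeAverage f x N : Measure X)) - ∫ z, h z ∂(timeAverage f x N : Measure X)
      = ((N + 1 : ℕ) : ℝ)⁻¹ * (h (f^[N + 1] x) - h x) := by
  rw [integral_timeAverage, integral_timeAverage, ← mul_sub, ← Finset.sum_sub_distrib]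
  congr 1
  have := Finset.sum_range_sub (fun j => h (f^[j] x)) (N + 1)
  simpa [Function.iterate_succ_apply'] using this

/-- Krylov–Bogolyubov: a limit of time averages of orbits in a closed forward invariant set, over
longer and longer time intervals, is an invariant measure supported on that set. -/
theorem mem_invariantMeasures_of_tendsto [T2Space X] [HasOuterApproxClosed X] {f : X → X}
    (hf : Continuous f) {A : Set X} (hA : IsClosed A) (hinv : MapsTo f A A) {x : ℕ → X} (hx : ∀ N, x N ∈ A)
    {l : Filter ℕ} [l.NeBot] (hl : l ≤ atTop) {μ : ProbabilityMeasure X}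
    (hμ : Tendsto (fun N => timeAverage f (x N) N) l (𝓝 μ)) : μ ∈ invariantMeasures f A := by
  constructor
  · refine ⟨hf.measurable, ?_⟩
    have : IsProbabilityMeasure (Measure.map f (μ : Measure X)) :=
      Measure.isProbabilityMeasure_map hf.aemeasurable
    refine ext_of_forall_integral_eq_of_IsFiniteMeasure fun h => ?_
    rw [integral_map hf.aemeasurable h.continuous.aestronglyMeasurable]
    have h1 := ProbabilityMeasure.tendsto_iff_forall_integral_tendsto.1 hμ
      (h.compContinuous ⟨f, hf⟩)
    have h2 := ProbabilityMeasure.tendsto_iff_forall_integral_tendsto.1 hμ h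
    have h3 := h1.sub h2
    have h4 : Tendsto (fun N : ℕ => ((N + 1 : ℕ) : ℝ)⁻¹ * (2 * ‖h‖)) l (𝓝 0) := by
      have := ((tendsto_inv_atTop_nhds_zero_nat (𝕜 := ℝ)).comp (tendsto_add_atTop_nat 1)).mul_const
        (2 * ‖h‖)
      rw [zero_mul] at this
      exact this.mono_left hl
    have h5 : Tendsto (fun N => (∫ z, (h.compContinuous ⟨f, hf⟩) z
        ∂(timeAverage f (x N) N : Measure X)) - ∫ z, h z ∂(timeAverage f (x N) N : Measure X))
        l (𝓝 0) := by
      refine squeeze_zero_norm (fun N => ?_) h4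
      have := integral_comp_sub_timeAverage f (x N) N h
      simp only [BoundedContinuousFunction.compContinuous_apply, ContinuousMap.coe_mk]
      rw [this, norm_mul, norm_inv, Real.norm_natCast]
      gcongr
      have h1 := norm_sub_le (h (f^[N + 1] (x N))) (h (x N))
      linarith [h.norm_coe_le_norm (f^[N + 1] (x N)), h.norm_coe_le_norm (x N)]
    exact sub_eq_zero.1 (tendsto_nhds_unique h3 h5)
  -- Portmanteau: the mass of a closed set cannot drop in a weak limit, and every average gives `A`
  -- mass one.
  · have h := ProbabilityMeasure.limsup_measure_closed_le_of_tendsto hμ hA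
    simp only [timeAverage_apply_eq_one f hA hinv (hx _), limsup_const] at h
    rw [prob_compl_eq_zero_iff hA.measurableSet]
    exact le_antisymm prob_le_one h

/-- If all invariant measures on `Λ` are limits of time averages along the orbit of `y`, a bound for
the Birkhoff averages along this orbit spreads to uniform bounds on `Λ`. -/
theorem eventually_forall_birkhoffSum_le [T2Space X] [CompactSpace X] [HasOuterApproxClosed X]
    {f : X → X} (hf : Continuous f) {Λ : Set X} (hΛ : IsClosed Λ) (hinv : MapsTo f Λ Λ) {y : X} (hy : y ∈ Λ)
    (hV : invariantMeasures f Λ ⊆ accumulationMeasures f y) {φ : X → ℝ} (hφ : ContinuousOn φ Λ)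
    {κ κ' : ℝ} (hκ : κ < κ')
    (hφy : ∀ᶠ n : ℕ in atTop, ∑ j ∈ Finset.range n, φ (f^[j] y) ≤ n * κ) :
    ∀ᶠ n : ℕ in atTop, ∀ x ∈ Λ, ∑ j ∈ Finset.range n, φ (f^[j] x) ≤ n * κ' := by
  -- Tietze extension: weak convergence tests only functions continuous on all of `X`, while orbits
  -- in `Λ` see only the values on `Λ`.
  obtain ⟨ψ, hψ⟩ := ContinuousMap.exists_restrict_eq hΛ ⟨_, hφ.domRestrict⟩
  have hψ' : ∀ x ∈ Λ, ψ x = φ x := fun x hx => congrArg (fun h => h ⟨x, hx⟩) hψ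
  have hsum : ∀ x ∈ Λ, ∀ n, ∑ j ∈ Finset.range n, ψ (f^[j] x)
      = ∑ j ∈ Finset.range n, φ (f^[j] x) := fun x hx n =>
    Finset.sum_congr rfl fun j _ => hψ' _ (hinv.iterate j hx)
  let Ψ := BoundedContinuousFunction.mkOfCompact ψ
  have hint : ∀ x ∈ Λ, ∀ N, ∫ z, Ψ z ∂(timeAverage f x N : Measure X)
      = ((N + 1 : ℕ) : ℝ)⁻¹ * ∑ j ∈ Finset.range (N + 1), φ (f^[j] x) := fun x hx N => by
    rw [integral_timeAverage, ← hsum x hx]; rfl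
  -- The `N`-th time average has `N + 1` points, so lengths are shifted by one.
  rw [← map_add_atTop_eq_nat 1, eventually_map]
  rw [← map_add_atTop_eq_nat 1, eventually_map] at hφy
  by_contra hcon
  rw [not_eventually] at hcon
  have hx : ∀ N : ℕ, ∃ x ∈ Λ,
      (¬ ∀ x ∈ Λ, ∑ j ∈ Finset.range (N + 1), φ (f^[j] x) ≤ (N + 1 : ℕ) * κ') →
        (N + 1 : ℕ) * κ' < ∑ j ∈ Finset.range (N + 1), φ (f^[j] x) := by
    intro N
    by_cases h : ∀ x ∈ Λ, ∑ j ∈ Finset.range (N + 1), φ (f^[j] x) ≤ (N + 1 : ℕ) * κ'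
    · exact ⟨y, hy, fun h' => absurd h h'⟩
    · push Not at h
      obtain ⟨x, hx, hlt⟩ := h
      exact ⟨x, hx, fun _ => hlt⟩
  choose x hxΛ hbad using hx
  have hne : (atTop ⊓ 𝓟 {N : ℕ | ¬ ∀ x ∈ Λ, ∑ j ∈ Finset.range (N + 1), φ (f^[j] x)
      ≤ (N + 1 : ℕ) * κ'}).NeBot := frequently_mem_iff_neBot.1 hcon
  let U := Ultrafilter.of (atTop ⊓ 𝓟 {N : ℕ | ¬ ∀ x ∈ Λ, ∑ j ∈ Finset.range (N + 1), φ (f^[j] x)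
      ≤ (N + 1 : ℕ) * κ'})
  have hU : (U : Filter ℕ) ≤ _ := Ultrafilter.of_le _
  obtain ⟨μ, -, hμ⟩ := isCompact_univ.ultrafilter_le_nhds
    (U.map fun N => timeAverage f (x N) N) (by simp)
  have hμ : Tendsto (fun N => timeAverage f (x N) N) U (𝓝 μ) := hμ
  have hge : κ' ≤ ∫ z, Ψ z ∂(μ : Measure X) := by
    refine ge_of_tendsto (ProbabilityMeasure.tendsto_iff_forall_integral_tendsto.1 hμ Ψ) ?_
    filter_upwards [hU (mem_inf_of_right (mem_principal_self _))] with N hN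
    rw [hint _ (hxΛ N), inv_mul_eq_div, le_div_iff₀ (by positivity), mul_comm]
    exact (hbad N hN).le
  -- The limit is invariant, so it is also reached along the orbit of `y`, where the smaller bound
  -- `κ` applies.
  obtain ⟨W, hW, hμW⟩ := mapClusterPt_iff_ultrafilter.1
    (hV (mem_invariantMeasures_of_tendsto hf hΛ hinv hxΛ (hU.trans inf_le_left) hμ))
  have hle : ∫ z, Ψ z ∂(μ : Measure X) ≤ κ := by
    refine le_of_tendsto (ProbabilityMeasure.tendsto_iff_forall_integral_tendsto.1 hμW Ψ) ?_
    filter_upwards [hW hφy] with N hN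
    rw [hint _ hy, inv_mul_eq_div, div_le_iff₀ (by positivity), mul_comm]
    exact hN
  linarith

end Averages

/-! ### Submultiplicative cocycles -/

section Cocycle

theorem sum_range_mul_eq_sum_residues (u : ℕ → ℝ) (k L : ℕ) :
    ∑ j ∈ Finset.range (k * L), u j
      = ∑ r ∈ Finset.range L, ∑ i ∈ Finset.range k, u (i * L + r) := by
  induction k with
  | zero => simp
  | succ k ih =>
    simp only [Finset.sum_range_succ, Finset.sum_add_distrib]
    rw [Nat.succ_mul, Finset.sum_range_add, ih]

variable {X : Type*} {f : X → X} {Λ : Set X} {a : ℕ → X → ℝ≥0∞}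

theorem cocycle_le_pow (hinv : MapsTo f Λ Λ) (h0 : ∀ x ∈ Λ, a 0 x ≤ 1)
    (hsub : ∀ x ∈ Λ, ∀ m n, a (m + n) x ≤ a m (f^[n] x) * a n x)
    {D : ℝ≥0∞} {m : ℕ} (hD : ∀ x ∈ Λ, a m x ≤ D) (n : ℕ) : ∀ x ∈ Λ, a (n * m) x ≤ D ^ n := by
  induction n with
  | zero => simpa using h0
  | succ n ih =>
    intro x hx
    rw [Nat.succ_mul, pow_succ]
    exact (hsub x hx _ _).trans (mul_le_mul' (ih _ (hinv.iterate m hx)) (hD x hx))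

theorem cocycle_le_exp_sum (hinv : MapsTo f Λ Λ) (h0 : ∀ x ∈ Λ, a 0 x ≤ 1)
    (hsub : ∀ x ∈ Λ, ∀ m n, a (m + n) x ≤ a m (f^[n] x) * a n x)
    {L : ℕ} {φ : X → ℝ} (hL : ∀ x ∈ Λ, a L x ≤ ENNReal.ofReal (Real.exp (φ x))) (k : ℕ) :
    ∀ x ∈ Λ, a (k * L) x
      ≤ ENNReal.ofReal (Real.exp (∑ i ∈ Finset.range k, φ (f^[i * L] x))) := by
  induction k with
  | zero => simpa using h0
  | succ k ih =>
    intro x hx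
    rw [Nat.succ_mul, add_comm, Finset.sum_range_succ, add_comm (Finset.sum _ _), Real.exp_add,
      ENNReal.ofReal_mul (Real.exp_nonneg _)]
    exact (hsub x hx _ _).trans (mul_le_mul' (hL _ (hinv.iterate _ hx)) (ih x hx))

/-- Negative Birkhoff sums of `log a L` make some later term of the submultiplicative cocycle
uniformly small. -/
theorem exists_cocycle_le_half (hinv : MapsTo f Λ Λ) (h0 : ∀ x ∈ Λ, a 0 x ≤ 1)
    (hsub : ∀ x ∈ Λ, ∀ m n, a (m + n) x ≤ a m (f^[n] x) * a n x)
    {D : ℝ} (hD1 : 1 ≤ D) (hD : ∀ x ∈ Λ, a 1 x ≤ ENNReal.ofReal D)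
    {L : ℕ} {φ : X → ℝ} (hL : ∀ x ∈ Λ, a L x ≤ ENNReal.ofReal (Real.exp (φ x)))
    {κ : ℝ} (hκ : 0 < κ)
    (hev : ∀ᶠ n : ℕ in atTop, ∀ x ∈ Λ, ∑ j ∈ Finset.range n, φ (f^[j] x) ≤ n * (-κ)) :
    ∃ m : ℕ, 0 < m ∧ ∀ x ∈ Λ, a m x ≤ ENNReal.ofReal (1 / 2) := by
  -- For `L = 0`, a negative sum forces `a 0 < 1` somewhere on the orbit piece; with `a 0 ≤ a 0 * a
  -- 0` this value is zero, and it annihilates `a n x`.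
  rcases Nat.eq_zero_or_pos L with rfl | hLpos
  · obtain ⟨n, hn, hnpos⟩ := (hev.and (eventually_gt_atTop 0)).exists
    refine ⟨n, hnpos, fun x hx => ?_⟩
    obtain ⟨j, hj, hneg⟩ : ∃ j ∈ Finset.range n, φ (f^[j] x) < 0 := by
      by_contra! hcon
      have h1 := Finset.sum_nonneg hcon
      have h2 : (0 : ℝ) < n := by exact_mod_cast hnpos
      nlinarith [hn x hx]
    have hxj := hinv.iterate j hx
    have hlt : a 0 (f^[j] x) < 1 := by
      refine (hL _ hxj).trans_lt ?_
      rw [← ENNReal.ofReal_one]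
      exact (ENNReal.ofReal_lt_ofReal_iff one_pos).2 (by simpa using hneg)
    have hz : a 0 (f^[j] x) = 0 := by
      by_contra hne
      have h1 : a 0 (f^[j] x) ≤ a 0 (f^[j] x) * a 0 (f^[j] x) := hsub _ hxj 0 0
      have h2 : a 0 (f^[j] x) * a 0 (f^[j] x) < 1 * a 0 (f^[j] x) :=
        ENNReal.mul_lt_mul_left hne (hlt.trans ENNReal.one_lt_top).ne hlt
      rw [one_mul] at h2
      exact absurd h1 h2.not_ge
    have haj : a j x = 0 := by
      have := hsub x hx 0 j
      rw [hz, zero_mul, zero_add] at this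
      exact le_antisymm this zero_le
    have := hsub x hx (n - j) j
    rw [haj, mul_zero, Nat.sub_add_cancel (Finset.mem_range.1 hj).le] at this
    exact this.trans zero_le
  · have hlim : Tendsto (fun k : ℕ => D ^ L * Real.exp (-(k * κ))) atTop (𝓝 (D ^ L * 0)) := by
      refine Tendsto.const_mul _ ?_
      exact Real.tendsto_exp_neg_atTop_nhds_zero.comp
        (tendsto_natCast_atTop_atTop.atTop_mul_const hκ)
    rw [mul_zero] at hlim
    have hev' := (tendsto_id.atTop_mul_const' hLpos : 
      Tendsto (fun k : ℕ => k * L) atTop atTop).eventually hev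
    obtain ⟨k, hk, hksum⟩ :=
      ((hlim.eventually (gt_mem_nhds (by norm_num : (0 : ℝ) < 1 / 2))).and hev').exists
    -- For a residue `r` depending on `x`, the time splits as `r` steps, `k` blocks of length `L`,
    -- and `L - r` steps. The loose steps cost `D ^ L` in all, whatever `r` is.
    refine ⟨k * L + L, by omega, fun x hx => ?_⟩
    -- Pigeonhole: the `L` residue sums total at most `-(k * L * κ)`.
    obtain ⟨r, hr, hrsum⟩ : ∃ r ∈ Finset.range L,
        ∑ i ∈ Finset.range k, φ (f^[i * L + r] x) ≤ -(k * κ) := by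
      refine Finset.exists_le_of_sum_le ⟨0, Finset.mem_range.2 hLpos⟩ ?_
      rw [← sum_range_mul_eq_sum_residues (fun j => φ (f^[j] x))]
      refine (hksum x hx).trans (le_of_eq ?_)
      simp only [Finset.sum_const, Finset.card_range, nsmul_eq_mul]
      push_cast
      ring
    have hrL : r < L := Finset.mem_range.1 hr
    have e1 : k * L + L = (L - r) + (k * L + r) := by omega
    have b1 : ∀ n, ∀ z ∈ Λ, a n z ≤ ENNReal.ofReal D ^ n := fun n z hz => by
      simpa using cocycle_le_pow hinv h0 hsub hD n z hz
    have b2 := cocycle_le_exp_sum hinv h0 hsub hL k _ (hinv.iterate r hx)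
    simp only [← Function.iterate_add_apply] at b2
    calc a (k * L + L) x ≤ a (L - r) (f^[k * L + r] x) * (a (k * L) (f^[r] x) * a r x) := by
          rw [e1]
          exact (hsub x hx _ _).trans (mul_le_mul' le_rfl (hsub x hx _ _))
      _ ≤ ENNReal.ofReal D ^ (L - r) * (ENNReal.ofReal (Real.exp (-(k * κ)))
            * ENNReal.ofReal D ^ r) := by
          refine mul_le_mul' (b1 _ _ (hinv.iterate _ hx)) (mul_le_mul' (b2.trans ?_) (b1 _ _ hx))
          exact ENNReal.ofReal_le_ofReal (Real.exp_le_exp.2 hrsum)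
      _ = ENNReal.ofReal (D ^ L * Real.exp (-(k * κ))) := by
          rw [ENNReal.ofReal_mul (by positivity), ENNReal.ofReal_pow (by positivity), mul_comm
            (ENNReal.ofReal (Real.exp _)), ← mul_assoc, ← pow_add, Nat.sub_add_cancel hrL.le]
      _ ≤ ENNReal.ofReal (1 / 2) := ENNReal.ofReal_le_ofReal hk.le

/-- Division of `n` by `m`: each full block contributes 1/2 = `lam ^ m`, and the remainder costs at
most `D ^ m`. The factor 2 in the constant absorbs `lam ^ (n % m) ≥ 1/2`. -/
theorem exists_cocycle_le_geometric (hinv : MapsTo f Λ Λ) (h0 : ∀ x ∈ Λ, a 0 x ≤ 1)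
    (hsub : ∀ x ∈ Λ, ∀ m n, a (m + n) x ≤ a m (f^[n] x) * a n x)
    {D : ℝ} (hD1 : 1 ≤ D) (hD : ∀ x ∈ Λ, a 1 x ≤ ENNReal.ofReal D)
    {m : ℕ} (hm : 0 < m) (ha : ∀ x ∈ Λ, a m x ≤ ENNReal.ofReal (1 / 2)) :
    ∃ C lam : ℝ, 0 < C ∧ 0 < lam ∧ lam < 1 ∧
      ∀ n, ∀ x ∈ Λ, a n x ≤ ENNReal.ofReal (C * lam ^ n) := by
  have hlam : (0 : ℝ) < (1 / 2) ^ ((m : ℝ)⁻¹) := by positivity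
  have hlam1 : ((1 / 2 : ℝ) ^ ((m : ℝ)⁻¹)) < 1 :=
    Real.rpow_lt_one (by norm_num) (by norm_num) (by positivity)
  have hpow : ((1 / 2 : ℝ) ^ ((m : ℝ)⁻¹)) ^ m = 1 / 2 :=
    Real.rpow_inv_natCast_pow (by norm_num) hm.ne'
  set lam : ℝ := (1 / 2) ^ ((m : ℝ)⁻¹)
  refine ⟨D ^ m * 2, lam, by positivity, hlam, hlam1, fun n x hx => ?_⟩
  have b1 : a (n % m) (f^[n / m * m] x) ≤ ENNReal.ofReal D ^ (n % m) := by
    simpa using cocycle_le_pow hinv h0 hsub hD (n % m) _ (hinv.iterate _ hx)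
  have b2 := cocycle_le_pow hinv h0 hsub ha (n / m) x hx
  have e : n = n % m + n / m * m := by rw [mul_comm, Nat.mod_add_div]
  have hlt := Nat.mod_lt n hm
  calc a n x ≤ a (n % m) (f^[n / m * m] x) * a (n / m * m) x := by
        conv_lhs => rw [e]
        exact hsub x hx _ _
    _ ≤ ENNReal.ofReal D ^ (n % m) * ENNReal.ofReal (1 / 2) ^ (n / m) := mul_le_mul' b1 b2
    _ = ENNReal.ofReal (D ^ (n % m) * (1 / 2) ^ (n / m)) := by
        rw [ENNReal.ofReal_mul (by positivity), ENNReal.ofReal_pow (by positivity),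
          ENNReal.ofReal_pow (by positivity)]
    _ ≤ ENNReal.ofReal (D ^ m * 2 * lam ^ n) := by
        refine ENNReal.ofReal_le_ofReal ?_
        have h1 : lam ^ n = lam ^ (n % m) * (1 / 2) ^ (n / m) := by
          conv_lhs => rw [e]
          rw [pow_add, mul_comm (n / m), pow_mul, hpow]
        have h2 : 1 / 2 ≤ lam ^ (n % m) := by
          rw [← hpow]
          exact pow_le_pow_of_le_one hlam.le hlam1.le hlt.le
        rw [h1, mul_assoc, ← mul_assoc 2]
        have h3 : D ^ (n % m) ≤ D ^ m := pow_le_pow_right₀ hD1 hlt.le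
        have h4 : (1 : ℝ) * (1 / 2) ^ (n / m) ≤ 2 * lam ^ (n % m) * (1 / 2) ^ (n / m) := by
          gcongr
          linarith
        rw [one_mul] at h4
        gcongr

end Cocycle

/-! ### Relative norms of two lengths on a subspace -/

section RelNorm

variable {V : Type*} [AddCommGroup V] [Module ℝ V]

/-- A finite, absolutely homogeneous and definite function on a vector space. -/
structure IsLength (p : V → ℝ≥0∞) : Prop where
  smul : ∀ (c : ℝ) v, p (c • v) = ENNReal.ofReal |c| * p v
  ne_zero : ∀ v, v ≠ 0 → p v ≠ 0
  ne_top : ∀ v, p v ≠ ⊤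

theorem IsLength.zero {p : V → ℝ≥0∞} (hp : IsLength p) : p 0 = 0 := by
  simpa using hp.smul 0 0

/-- The supremum of `q` over the vectors of `S` of `p`-length at most one. -/
noncomputable def relNorm (p q : V → ℝ≥0∞) (S : Submodule ℝ V) : ℝ≥0∞ :=
  ⨆ v ∈ S, ⨆ _ : p v ≤ 1, q v

variable {p q : V → ℝ≥0∞} {S : Submodule ℝ V}

theorem relNorm_le_iff (hp : IsLength p) (hq : IsLength q) {C : ℝ≥0∞} :
    relNorm p q S ≤ C ↔ ∀ v ∈ S, q v ≤ C * p v := by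
  refine ⟨fun h v hv => ?_, fun h => ?_⟩
  · rcases eq_or_ne v 0 with rfl | hv0
    · simp [hq.zero]
    have hpos : 0 < (p v).toReal := ENNReal.toReal_pos (hp.ne_zero v hv0) (hp.ne_top v)
    have hc : ENNReal.ofReal |(p v).toReal⁻¹| = (p v)⁻¹ := by
      rw [abs_of_pos (inv_pos.2 hpos), ENNReal.ofReal_inv_of_pos hpos,
        ENNReal.ofReal_toReal (hp.ne_top v)]
    have h1 : p ((p v).toReal⁻¹ • v) ≤ 1 := by
      rw [hp.smul, hc, ENNReal.inv_mul_cancel (hp.ne_zero v hv0) (hp.ne_top v)]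
    have h2 : q ((p v).toReal⁻¹ • v) ≤ C :=
      le_trans (le_iSup₂_of_le ((p v).toReal⁻¹ • v) (S.smul_mem _ hv) 
        (le_iSup (fun _ : p ((p v).toReal⁻¹ • v) ≤ 1 => q ((p v).toReal⁻¹ • v)) h1)) h
    rwa [hq.smul, hc, mul_comm, ← ENNReal.div_eq_inv_mul.trans (mul_comm _ _),
      ENNReal.div_le_iff (hp.ne_zero v hv0) (hp.ne_top v)] at h2
  · refine iSup₂_le fun v hv => iSup_le fun h1 => (h v hv).trans ?_
    simpa using mul_le_mul' (le_refl C) h1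

theorem le_relNorm_mul (hp : IsLength p) (hq : IsLength q) {v : V} (hv : v ∈ S) :
    q v ≤ relNorm p q S * p v :=
  (relNorm_le_iff hp hq).1 le_rfl v hv

theorem relNorm_bot (hp : IsLength p) (hq : IsLength q) :
    relNorm p q (⊥ : Submodule ℝ V) = 0 := by
  refine le_antisymm ((relNorm_le_iff hp hq).2 ?_) zero_le
  simp [hq.zero]

/-- Comparing back and forth on one nonzero vector suffices. An upper bound for one relative norm
thus bounds the other away from zero, which keeps its logarithm finite. -/
theorem one_le_relNorm_mul_relNorm (hp : IsLength p) (hq : IsLength q) (hS : S ≠ ⊥) :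
    1 ≤ relNorm q p S * relNorm p q S := by
  obtain ⟨v, hv, hv0⟩ := S.ne_bot_iff.1 hS
  have h : 1 * p v ≤ relNorm q p S * relNorm p q S * p v := by
    rw [one_mul, mul_assoc]
    exact (le_relNorm_mul hq hp hv).trans (mul_le_mul' le_rfl (le_relNorm_mul hp hq hv))
  exact (ENNReal.mul_le_mul_iff_left (hp.ne_zero v hv0) (hp.ne_top v)).1 h

/-- In terms of a basis, the relative norm is a supremum over the unit sphere of the
coordinate space. -/
theorem relNorm_eq_sSup_sphere (hp : IsLength p) (hq : IsLength q) {k : ℕ} {s : Fin k → V}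
    (hs : LinearIndependent ℝ s) (hspan : Submodule.span ℝ (Set.range s) = S) :
    relNorm p q S = sSup ((fun c : Fin k → ℝ => q (∑ i, c i • s i) / p (∑ i, c i • s i)) ''
      Metric.sphere 0 1) := by
  have hne : ∀ c : Fin k → ℝ, c ≠ 0 → ∑ i, c i • s i ≠ 0 := fun c hc h0 =>
    hc (funext fun i => Fintype.linearIndependent_iff.1 hs c h0 i)
  refine le_antisymm ((relNorm_le_iff hp hq).2 fun v hv => ?_) (sSup_le ?_)
  · rw [← hspan, Submodule.mem_span_range_iff_exists_fun] at hv
    obtain ⟨c, rfl⟩ := hv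
    rcases eq_or_ne c 0 with rfl | hc
    · simp [hq.zero]
    have hc' : ‖c‖ ≠ 0 := norm_ne_zero_iff.2 hc
    set u : Fin k → ℝ := ‖c‖⁻¹ • c
    have hu : u ∈ Metric.sphere (0 : Fin k → ℝ) 1 := by
      simp [u, norm_smul, hc']
    have hcu : ∑ i, c i • s i = ‖c‖ • ∑ i, u i • s i := by
      simp [u, Finset.smul_sum, smul_smul, hc']
    have hu0 : ∑ i, u i • s i ≠ 0 := hne u (by rintro h; simp [h] at hu)
    have hle := le_sSup (mem_image_of_mem
      (fun c : Fin k → ℝ => q (∑ i, c i • s i) / p (∑ i, c i • s i)) hu)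
    rw [ENNReal.div_le_iff (hp.ne_zero _ hu0) (hp.ne_top _)] at hle
    rw [hcu, hq.smul, hp.smul, mul_left_comm]
    exact mul_le_mul' le_rfl hle
  · rintro _ ⟨c, hc, rfl⟩
    have hc0 : c ≠ 0 := by rintro rfl; simp at hc
    refine (ENNReal.div_le_iff (hp.ne_zero _ (hne c hc0)) (hp.ne_top _)).2 ?_
    refine le_relNorm_mul hp hq ?_
    rw [← hspan, Submodule.mem_span_range_iff_exists_fun]
    exact ⟨c, rfl⟩

/-- The supremum of a jointly continuous function over a compact space is continuous in the
parameter, and it is attained, hence finite. -/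
theorem continuous_sSup_div_sphere {Y : Type*} [TopologicalSpace Y] {k : ℕ}
    {P Q : Y → (Fin k → ℝ) → ℝ≥0∞} (hP : Continuous fun z : Y × (Fin k → ℝ) => P z.1 z.2)
    (hQ : Continuous fun z : Y × (Fin k → ℝ) => Q z.1 z.2)
    (hP0 : ∀ y, ∀ c ∈ Metric.sphere (0 : Fin k → ℝ) 1, P y c ≠ 0) (hQt : ∀ y c, Q y c ≠ ⊤) :
    Continuous (fun y => sSup ((fun c => Q y c / P y c) '' Metric.sphere 0 1)) ∧
      ∀ y, sSup ((fun c => Q y c / P y c) '' Metric.sphere 0 1) < ⊤ := by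
  let r : Y → Metric.sphere (0 : Fin k → ℝ) 1 → ℝ≥0∞ := fun y c => Q y c / P y c
  have hr : Continuous fun z : Y × Metric.sphere (0 : Fin k → ℝ) 1 => r z.1 z.2 := by
    have hi : Continuous fun z : Y × Metric.sphere (0 : Fin k → ℝ) 1 =>
        (z.1, (z.2 : Fin k → ℝ)) := by fun_prop
    exact continuous_iff_continuousAt.2 fun z => ENNReal.Tendsto.div (hQ.comp hi).continuousAt
      (Or.inr (hP0 z.1 z.2 z.2.2)) (hP.comp hi).continuousAt (Or.inr (hQt z.1 z.2))
  have hcpt : IsCompact (univ : Set (Metric.sphere (0 : Fin k → ℝ) 1)) :=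
    isCompact_iff_isCompact_univ.1 (isCompact_sphere _ _)
  have himg : ∀ y, (fun c => Q y c / P y c) '' Metric.sphere 0 1 = r y '' univ := fun y => by
    rw [image_univ, image_eq_range]
  simp only [himg]
  refine ⟨hcpt.continuous_sSup hr, fun y => ?_⟩
  -- The sphere is empty for `k = 0`, the zero bundle; the supremum is then zero.
  rcases (univ : Set (Metric.sphere (0 : Fin k → ℝ) 1)).eq_empty_or_nonempty with h | h
  · rw [h, image_empty, sSup_empty]
    exact ENNReal.zero_lt_top
  · obtain ⟨c, -, hmax⟩ := hcpt.exists_isMaxOn h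
      (hr.comp (Continuous.prodMk_right y)).continuousOn
    refine lt_of_le_of_lt (sSup_le ?_) (ENNReal.div_lt_top (hQt y c) (hP0 y c c.2))
    rintro _ ⟨c', -, rfl⟩
    exact hmax (mem_univ c')

end RelNorm

/-! ### Lengths of iterated derivatives and their continuity -/

section Derivative

open scoped Bundle

variable {d : ℕ} {M : Type*} [TopologicalSpace M] [ChartedSpace (EuclideanSpace ℝ (Fin d)) M]

theorem isLocalDiffeomorph_iterate [IsManifold (𝓡 d) ∞ M] {f : M → M}
    (hf : IsLocalDiffeomorph (𝓡 d) (𝓡 d) 1 f) (n : ℕ) :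
    IsLocalDiffeomorph (𝓡 d) (𝓡 d) 1 f^[n] := by
  induction n with
  | zero => exact (Diffeomorph.refl (𝓡 d) M 1).isLocalDiffeomorph
  | succ n ih => exact fun x => IsLocalDiffeomorphAt.comp (𝓡 d) M (hf x) (ih (f x))

variable [IsManifold (𝓡 d) ∞ M] {f : M → M}

theorem mfderiv_iterate_add (hf : IsLocalDiffeomorph (𝓡 d) (𝓡 d) 1 f) (m n : ℕ) (x : M)
    (v : TangentSpace (𝓡 d) x) :
    mfderiv (𝓡 d) (𝓡 d) f^[m + n] x v
      = mfderiv (𝓡 d) (𝓡 d) f^[m] (f^[n] x) (mfderiv (𝓡 d) (𝓡 d) f^[n] x v) := by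
  have h := fun n => (isLocalDiffeomorph_iterate hf n).mdifferentiable one_ne_zero
  rw [Function.iterate_add, mfderiv_comp x (h m _) (h n x)]
  rfl

theorem mfderiv_iterate_injective (hf : IsLocalDiffeomorph (𝓡 d) (𝓡 d) 1 f) (n : ℕ) (x : M) :
    Function.Injective (mfderiv (𝓡 d) (𝓡 d) f^[n] x) :=
  ((isLocalDiffeomorph_iterate hf n).mfderivToContinuousLinearEquiv one_ne_zero x).injective

theorem Metric.continuousOn_inner (g : Metric d M) {N : Type*} [TopologicalSpace N] {A : Set N}
    {b : N → M} {v w : ∀ x : N, TangentSpace (𝓡 d) (b x)}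
    (hv : ContinuousOn (fun x => (⟨b x, v x⟩ : TangentBundle (𝓡 d) M)) A)
    (hw : ContinuousOn (fun x => (⟨b x, w x⟩ : TangentBundle (𝓡 d) M)) A) :
    ContinuousOn (fun x => g.inner (b x) (v x) (w x)) A := by
  let _ : Bundle.RiemannianBundle (TangentSpace (𝓡 d) : M → Type _) := ⟨g.toRiemannianMetric⟩
  exact ContinuousOn.inner_bundle (E := (TangentSpace (𝓡 d) : M → Type _)) hv hw

theorem Metric.isLength (g : Metric d M) (x : M) : IsLength (g.length x) where
  smul c v := by
    simp only [Metric.length, map_smul, smul_apply, smul_eq_mul]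
    rw [← mul_assoc, Real.sqrt_mul (mul_self_nonneg c), Real.sqrt_mul_self_eq_abs,
      ENNReal.ofReal_mul (abs_nonneg c)]
  ne_zero v hv := by
    simpa [Metric.length] using g.pos x v hv
  ne_top v := ENNReal.ofReal_ne_top

/-- The length of `Df^n(x) v`. -/
noncomputable def dlen (g : Metric d M) (f : M → M) (n : ℕ) (x : M)
    (v : TangentSpace (𝓡 d) x) : ℝ≥0∞ :=
  g.length (f^[n] x) (mfderiv (𝓡 d) (𝓡 d) f^[n] x v)

theorem dlen_zero (g : Metric d M) (x : M) : dlen g f 0 x = g.length x := by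
  funext v
  simp only [dlen, Function.iterate_zero, mfderiv_id]
  rfl

theorem dlen_add (hf : IsLocalDiffeomorph (𝓡 d) (𝓡 d) 1 f) (g : Metric d M) (m n : ℕ) (x : M)
    (v : TangentSpace (𝓡 d) x) :
    dlen g f (m + n) x v = dlen g f m (f^[n] x) (mfderiv (𝓡 d) (𝓡 d) f^[n] x v) := by
  unfold dlen
  rw [mfderiv_iterate_add hf, Function.iterate_add_apply]

theorem isLength_dlen (hf : IsLocalDiffeomorph (𝓡 d) (𝓡 d) 1 f) (g : Metric d M) (n : ℕ) (x : M) :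
    IsLength (dlen g f n x) where
  smul c v := by
    unfold dlen
    rw [map_smul, (g.isLength _).smul]
  ne_zero v hv := (g.isLength _).ne_zero _ fun h =>
    hv (mfderiv_iterate_injective hf n x (by rw [h, map_zero]))
  ne_top v := (g.isLength _).ne_top _

/-- In a continuous frame, the length of `Df^n(x) v` depends continuously on the point and on the
coordinates of `v`. -/
theorem continuous_dlen_frame (hf : IsLocalDiffeomorph (𝓡 d) (𝓡 d) 1 f) (g : Metric d M) (n : ℕ)
    {A : Set M} {k : ℕ} {s : Fin k → ∀ x : M, TangentSpace (𝓡 d) x}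
    (hs : ∀ i, ContinuousOn (fun x => (⟨x, s i x⟩ : TangentBundle (𝓡 d) M)) A) :
    Continuous fun z : A × (Fin k → ℝ) => dlen g f n z.1 (∑ i, z.2 i • s i z.1) := by
  have hT : Continuous (tangentMap (𝓡 d) (𝓡 d) f^[n]) :=
    (isLocalDiffeomorph_iterate hf n).contMDiff.continuous_tangentMap le_rfl
  have hij : ∀ i j, Continuous fun x : A => g.inner (f^[n] x) (mfderiv (𝓡 d) (𝓡 d) f^[n] x (s i x))
      (mfderiv (𝓡 d) (𝓡 d) f^[n] x (s j x)) := fun i j =>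
    continuousOn_iff_continuous_domRestrict.1 (g.continuousOn_inner (b := f^[n])
      (v := fun x => mfderiv (𝓡 d) (𝓡 d) f^[n] x (s i x))
      (w := fun x => mfderiv (𝓡 d) (𝓡 d) f^[n] x (s j x))
      (hT.comp_continuousOn (hs i)) (hT.comp_continuousOn (hs j)))
  have hij' : ∀ i j, Continuous fun z : A × (Fin k → ℝ) => g.inner (f^[n] z.1)
      (mfderiv (𝓡 d) (𝓡 d) f^[n] z.1 (s i z.1)) (mfderiv (𝓡 d) (𝓡 d) f^[n] z.1 (s j z.1)) :=
    fun i j => (hij i j).comp continuous_fst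
  refine ENNReal.continuous_ofReal.comp (Real.continuous_sqrt.comp ?_)
  simp only [map_sum, map_smul, sum_apply, smul_apply, smul_eq_mul]
  fun_prop

theorem continuousOn_relNorm_dlen_and_lt_top (hf : IsLocalDiffeomorph (𝓡 d) (𝓡 d) 1 f)
    (g g' : Metric d M) (m n : ℕ) {A : Set M} {S : ∀ x : M, Submodule ℝ (TangentSpace (𝓡 d) x)}
    (hS : IsContinuousSubbundle A S) :
    ContinuousOn (fun x => relNorm (dlen g f m x) (dlen g' f n x) (S x)) A ∧
      ∀ x ∈ A, relNorm (dlen g f m x) (dlen g' f n x) (S x) < ⊤ := by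
  have key : ∀ x₀ ∈ A, ∃ U : Set M, IsOpen U ∧ x₀ ∈ U ∧
      ContinuousOn (fun x => relNorm (dlen g f m x) (dlen g' f n x) (S x)) (A ∩ U) ∧
      relNorm (dlen g f m x₀) (dlen g' f n x₀) (S x₀) < ⊤ := by
    intro x₀ hx₀
    obtain ⟨U, hU, hxU, k, s, hs, hspan⟩ := hS x₀ hx₀
    have heq : ∀ x ∈ A ∩ U, relNorm (dlen g f m x) (dlen g' f n x) (S x) = _ := fun x hx =>
      relNorm_eq_sSup_sphere (isLength_dlen hf g m x) (isLength_dlen hf g' n x)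
        (hspan x hx).1 (hspan x hx).2
    have hne : ∀ x ∈ A ∩ U, ∀ c ∈ Metric.sphere (0 : Fin k → ℝ) 1, ∑ i, c i • s i x ≠ 0 := by
      intro x hx c hc h0
      have : c = 0 := funext fun i => Fintype.linearIndependent_iff.1 (hspan x hx).1 c h0 i
      simp [this] at hc
    obtain ⟨hcont, hlt⟩ := continuous_sSup_div_sphere (Y := ↥(A ∩ U))
      (P := fun x c => dlen g f m x (∑ i, c i • s i x))
      (Q := fun x c => dlen g' f n x (∑ i, c i • s i x)) (continuous_dlen_frame hf g m hs)
      (continuous_dlen_frame hf g' n hs)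
      (fun x c hc => (isLength_dlen hf g m _).ne_zero _ (hne x.1 x.2 c hc))
      (fun x c => (isLength_dlen hf g' n _).ne_top _)
    refine ⟨U, hU, hxU, ?_, ?_⟩
    · refine ContinuousOn.congr ?_ heq
      rw [continuousOn_iff_continuous_domRestrict]
      exact hcont
    · rw [heq x₀ ⟨hx₀, hxU⟩]
      exact hlt ⟨x₀, hx₀, hxU⟩
  refine ⟨fun x hx => ?_, fun x hx => ?_⟩
  · obtain ⟨U, hU, hxU, hc, -⟩ := key x hx
    exact (hc x ⟨hx, hxU⟩).mono_of_mem_nhdsWithin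
      (inter_mem self_mem_nhdsWithin (mem_nhdsWithin_of_mem_nhds (hU.mem_nhds hxU)))
  · obtain ⟨U, hU, hxU, -, hlt⟩ := key x hx
    exact hlt

theorem exists_relNorm_dlen_le (hf : IsLocalDiffeomorph (𝓡 d) (𝓡 d) 1 f)
    (g g' : Metric d M) (m n : ℕ) {A : Set M} (hA : IsCompact A)
    {S : ∀ x : M, Submodule ℝ (TangentSpace (𝓡 d) x)} (hS : IsContinuousSubbundle A S) :
    ∃ D : ℝ, 1 ≤ D ∧
      ∀ x ∈ A, relNorm (dlen g f m x) (dlen g' f n x) (S x) ≤ ENNReal.ofReal D := by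
  obtain ⟨hc, hlt⟩ := continuousOn_relNorm_dlen_and_lt_top hf g g' m n hS
  rcases A.eq_empty_or_nonempty with rfl | hne
  · exact ⟨1, le_rfl, by simp⟩
  obtain ⟨x, hx, hmax⟩ := hA.exists_isMaxOn hne hc
  refine ⟨max 1 (relNorm (dlen g f m x) (dlen g' f n x) (S x)).toReal, le_max_left _ _,
    fun z hz => (hmax hz).trans ?_⟩
  refine (ENNReal.ofReal_toReal (hlt x hx).ne).symm.le.trans
    (ENNReal.ofReal_le_ofReal (le_max_right _ _))

theorem normOn_eq_relNorm (g : Metric d M) (n : ℕ) (x : M)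
    (S : Submodule ℝ (TangentSpace (𝓡 d) x)) :
    normOn g f n x S = relNorm (dlen g f 0 x) (dlen g f n x) S := by
  rw [dlen_zero]; rfl

theorem invNormOn_eq_relNorm (g : Metric d M) (n : ℕ) (x : M)
    (S : Submodule ℝ (TangentSpace (𝓡 d) x)) :
    invNormOn g f n x S = relNorm (dlen g f n x) (dlen g f 0 x) S := by
  rw [dlen_zero]; rfl

end Derivative

theorem coe_ereal_sum_range (u : ℕ → ℝ) (k : ℕ) :
    ((∑ j ∈ Finset.range k, u j : ℝ) : EReal) = ∑ j ∈ Finset.range k, (u j : EReal) := by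
  induction k with
  | zero => simp
  | succ k ih => rw [Finset.sum_range_succ, Finset.sum_range_succ, EReal.coe_add, ih]

/-! ### From the orbit of `y` to uniform rates on `Λ` -/

section Hyperbolicity

variable {d : ℕ} {M : Type*} [TopologicalSpace M] [ChartedSpace (EuclideanSpace ℝ (Fin d)) M]
  [IsManifold (𝓡 d) ∞ M] {f : M → M} {Λ : Set M}
  {S : ∀ x : M, Submodule ℝ (TangentSpace (𝓡 d) x)}

theorem mfderiv_iterate_mem (hf : IsLocalDiffeomorph (𝓡 d) (𝓡 d) 1 f) (hinv : MapsTo f Λ Λ)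
    (hmap : ∀ x ∈ Λ, (S x).map (mfderiv (𝓡 d) (𝓡 d) f x).toLinearMap = S (f x)) (n : ℕ) {x : M}
    (hx : x ∈ Λ) {v : TangentSpace (𝓡 d) x} (hv : v ∈ S x) :
    mfderiv (𝓡 d) (𝓡 d) f^[n] x v ∈ S (f^[n] x) := by
  induction n with
  | zero =>
    simp only [Function.iterate_zero, mfderiv_id]
    exact hv
  | succ n ih =>
    rw [Function.iterate_succ', mfderiv_comp x (hf.mdifferentiable one_ne_zero _)
      ((isLocalDiffeomorph_iterate hf n).mdifferentiable one_ne_zero x)]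
    have := Submodule.mem_map_of_mem (f := (mfderiv (𝓡 d) (𝓡 d) f (f^[n] x)).toLinearMap) ih
    rw [hmap _ (hinv.iterate n hx)] at this
    exact this

theorem iterate_eq_bot_iff (hf : IsLocalDiffeomorph (𝓡 d) (𝓡 d) 1 f) (hinv : MapsTo f Λ Λ)
    (hmap : ∀ x ∈ Λ, (S x).map (mfderiv (𝓡 d) (𝓡 d) f x).toLinearMap = S (f x)) (n : ℕ) {x : M}
    (hx : x ∈ Λ) : S (f^[n] x) = ⊥ ↔ S x = ⊥ := by
  induction n with
  | zero => rfl
  | succ n ih =>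
    rw [← ih, Function.iterate_succ_apply', ← hmap _ (hinv.iterate n hx)]
    refine ⟨fun h => ?_, fun h => by rw [h, Submodule.map_bot]⟩
    exact Submodule.map_injective_of_injective (mfderiv_iterate_injective hf 1 (f^[n] x))
      (h.trans (Submodule.map_bot _).symm)

/-- The logarithm is -∞ on zero fibres, so the relative norm is truncated from below at `c > 0`.
Nonzero fibres already have norm at least `D⁻¹`, so truncation changes nothing there. By injectivity
of the derivative, the fibres along the orbit of `y` are all zero or all nonzero. -/
theorem exists_log_relNorm_majorant (hf : IsLocalDiffeomorph (𝓡 d) (𝓡 d) 1 f)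
    (hΛ : IsCompact Λ) (hinv : MapsTo f Λ Λ) (hS : IsContinuousSubbundle Λ S)
    (hmap : ∀ x ∈ Λ, (S x).map (mfderiv (𝓡 d) (𝓡 d) f x).toLinearMap = S (f x))
    (g : Metric d M) (m n : ℕ) {y : M} (hy : y ∈ Λ) {η : ℝ} (hη : 0 < η)
    (hlim : limsup (fun k : ℕ => (((k : ℝ)⁻¹ : ℝ) : EReal) * ∑ j ∈ Finset.range k,
      ENNReal.log (relNorm (dlen g f m (f^[j] y)) (dlen g f n (f^[j] y)) (S (f^[j] y)))) atTop
        ≤ ((-η : ℝ) : EReal)) :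
    ∃ φ : M → ℝ, ContinuousOn φ Λ ∧
      (∀ x ∈ Λ, relNorm (dlen g f m x) (dlen g f n x) (S x)
        ≤ ENNReal.ofReal (Real.exp (φ x))) ∧
      ∀ᶠ k : ℕ in atTop, ∑ j ∈ Finset.range k, φ (f^[j] y) ≤ k * (-(η / 2)) := by
  obtain ⟨hc, hlt⟩ := continuousOn_relNorm_dlen_and_lt_top hf g g m n hS
  obtain ⟨D, hD1, hD⟩ := exists_relNorm_dlen_le hf g g n m hΛ hS
  set h : M → ℝ≥0∞ := fun x => relNorm (dlen g f m x) (dlen g f n x) (S x)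
  replace hlt : ∀ x ∈ Λ, h x < ⊤ := hlt
  have hlow : ∀ x ∈ Λ, S x ≠ ⊥ → D⁻¹ ≤ (h x).toReal := by
    intro x hx hne
    have h1 := one_le_relNorm_mul_relNorm (isLength_dlen hf g m x) (isLength_dlen hf g n x) hne
    have h2 : 1 ≤ ENNReal.ofReal D * h x := h1.trans (mul_le_mul' (hD x hx) le_rfl)
    rw [← ENNReal.ofReal_toReal (hlt x hx).ne, ← ENNReal.ofReal_mul (by positivity),
      ENNReal.one_le_ofReal] at h2
    rw [inv_le_iff_one_le_mul₀' (by positivity)]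
    exact h2
  -- `D⁻¹` leaves nonzero fibres untouched; `exp (-η)` makes the truncated logarithm at most -η on
  -- zero fibres.
  set c : ℝ := min D⁻¹ (Real.exp (-η))
  have hcpos : 0 < c := lt_min (by positivity) (Real.exp_pos _)
  have hmpos : ∀ x, 0 < max (h x).toReal c := fun x => lt_max_of_lt_right hcpos
  refine ⟨fun x => Real.log (max (h x).toReal c), ?_, fun x hx => ?_, ?_⟩
  · refine ContinuousOn.log (ContinuousOn.sup ?_ continuousOn_const) fun x _ => (hmpos x).ne'
    exact ENNReal.continuousOn_toReal.comp hc fun x hx => (hlt x hx).ne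
  · rw [Real.exp_log (hmpos x)]
    refine (ENNReal.ofReal_toReal (hlt x hx).ne).symm.le.trans ?_
    exact ENNReal.ofReal_le_ofReal (le_max_left _ _)
  · rcases eq_or_ne (S y) ⊥ with hbot | hbot
    · have hz : ∀ j, h (f^[j] y) = 0 := fun j => by
        simp only [h]
        rw [(iterate_eq_bot_iff hf hinv hmap j hy).2 hbot]
        exact relNorm_bot (isLength_dlen hf g m _) (isLength_dlen hf g n _)
      refine Eventually.of_forall fun k => ?_
      simp only [hz, ENNReal.toReal_zero, max_eq_right hcpos.le, Finset.sum_const,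
        Finset.card_range, nsmul_eq_mul]
      have : Real.log c ≤ -η :=
        (Real.log_le_log hcpos (min_le_right _ _)).trans_eq (Real.log_exp _)
      gcongr
      linarith
    · have hlog : ∀ j, ENNReal.log (h (f^[j] y))
          = ((Real.log (max (h (f^[j] y)).toReal c) : ℝ) : EReal) := fun j => by
        have hyj := hinv.iterate j hy
        have hl := hlow _ hyj (mt (iterate_eq_bot_iff hf hinv hmap j hy).1 hbot)
        have hpos : 0 < (h (f^[j] y)).toReal := lt_of_lt_of_le (by positivity) hl
        rw [max_eq_left ((min_le_left _ _).trans hl)]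
        exact ENNReal.log_pos_real (ENNReal.toReal_pos_iff.1 hpos).1.ne' (hlt _ hyj).ne
      have hlim' := eventually_lt_of_limsup_lt (hlim.trans_lt
        (EReal.coe_lt_coe_iff.2 (by linarith : -η < -(η / 2))))
      filter_upwards [hlim', eventually_gt_atTop 0] with k hk hk0
      have hk0 : (0 : ℝ) < k := by exact_mod_cast hk0
      simp only [h] at hlog
      simp only [hlog] at hk
      rw [← coe_ereal_sum_range, ← EReal.coe_mul, EReal.coe_lt_coe_iff, inv_mul_lt_iff₀ hk0] at hk
      exact hk.le

/-- The metrics are compared at the two endpoints only, on image vectors that stay in `S` by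
invariance; the constants therefore do not depend on `m` and `n`. -/
theorem relNorm_dlen_change_metric (hf : IsLocalDiffeomorph (𝓡 d) (𝓡 d) 1 f)
    (hinv : MapsTo f Λ Λ)
    (hmap : ∀ x ∈ Λ, (S x).map (mfderiv (𝓡 d) (𝓡 d) f x).toLinearMap = S (f x))
    {g g' : Metric d M} {D D' : ℝ≥0∞}
    (hD : ∀ x ∈ Λ, relNorm (dlen g f 0 x) (dlen g' f 0 x) (S x) ≤ D)
    (hD' : ∀ x ∈ Λ, relNorm (dlen g' f 0 x) (dlen g f 0 x) (S x) ≤ D') (m n : ℕ) {x : M}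
    (hx : x ∈ Λ) :
    relNorm (dlen g f m x) (dlen g f n x) (S x)
      ≤ D' * D * relNorm (dlen g' f m x) (dlen g' f n x) (S x) := by
  have h : ∀ {g g' : Metric d M} {D : ℝ≥0∞},
      (∀ x ∈ Λ, relNorm (dlen g f 0 x) (dlen g' f 0 x) (S x) ≤ D) → ∀ n, ∀ v ∈ S x,
      dlen g' f n x v ≤ D * dlen g f n x v := by
    intro g g' D hD n v hv
    have := (relNorm_le_iff (isLength_dlen hf g 0 _) (isLength_dlen hf g' 0 _)).1
      (hD _ (hinv.iterate n hx)) _ (mfderiv_iterate_mem hf hinv hmap n hx hv)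
    rwa [← dlen_add hf, ← dlen_add hf, zero_add] at this
  refine (relNorm_le_iff (isLength_dlen hf g m x) (isLength_dlen hf g n x)).2 fun v hv => ?_
  calc dlen g f n x v ≤ D' * dlen g' f n x v := h hD' n v hv
    _ ≤ D' * (relNorm (dlen g' f m x) (dlen g' f n x) (S x) * (D * dlen g f m x v)) :=
        mul_le_mul' le_rfl ((le_relNorm_mul (isLength_dlen hf g' m x) (isLength_dlen hf g' n x)
          hv).trans (mul_le_mul' le_rfl (h hD m v hv)))
    _ = _ := by ring

theorem normOn_add_le (hf : IsLocalDiffeomorph (𝓡 d) (𝓡 d) 1 f) (hinv : MapsTo f Λ Λ)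
    (hmap : ∀ x ∈ Λ, (S x).map (mfderiv (𝓡 d) (𝓡 d) f x).toLinearMap = S (f x))
    (g : Metric d M) {x : M} (hx : x ∈ Λ) (m n : ℕ) :
    relNorm (dlen g f 0 x) (dlen g f (m + n) x) (S x)
      ≤ relNorm (dlen g f 0 (f^[n] x)) (dlen g f m (f^[n] x)) (S (f^[n] x))
        * relNorm (dlen g f 0 x) (dlen g f n x) (S x) := by
  have hl := isLength_dlen hf g
  refine (relNorm_le_iff (hl 0 x) (hl _ x)).2 fun v hv => ?_
  have h1 := le_relNorm_mul (hl 0 _) (hl m _) (mfderiv_iterate_mem hf hinv hmap n hx hv)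
  rw [← dlen_add hf, ← dlen_add hf, zero_add] at h1
  rw [mul_assoc]
  exact h1.trans (mul_le_mul' le_rfl (le_relNorm_mul (hl 0 x) (hl n x) hv))

theorem invNormOn_add_le (hf : IsLocalDiffeomorph (𝓡 d) (𝓡 d) 1 f) (hinv : MapsTo f Λ Λ)
    (hmap : ∀ x ∈ Λ, (S x).map (mfderiv (𝓡 d) (𝓡 d) f x).toLinearMap = S (f x))
    (g : Metric d M) {x : M} (hx : x ∈ Λ) (m n : ℕ) :
    relNorm (dlen g f (m + n) x) (dlen g f 0 x) (S x)
      ≤ relNorm (dlen g f m (f^[n] x)) (dlen g f 0 (f^[n] x)) (S (f^[n] x))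
        * relNorm (dlen g f n x) (dlen g f 0 x) (S x) := by
  have hl := isLength_dlen hf g
  refine (relNorm_le_iff (hl _ x) (hl 0 x)).2 fun v hv => ?_
  have h1 := le_relNorm_mul (hl m _) (hl 0 _) (mfderiv_iterate_mem hf hinv hmap n hx hv)
  rw [← dlen_add hf, ← dlen_add hf, zero_add] at h1
  calc dlen g f 0 x v ≤ relNorm (dlen g f n x) (dlen g f 0 x) (S x) * dlen g f n x v :=
        le_relNorm_mul (hl n x) (hl 0 x) hv
    _ ≤ _ := mul_le_mul' le_rfl h1
    _ = _ := by ring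

/-- The common core of the estimates along `E` and `F`: here `i n = 0, o n = n` gives the norms of
`Df^n` on `S`, and `i n = n, o n = 0` the norms of the inverses. -/
theorem exists_relNorm_le_geometric [T2Space M] [CompactSpace M] [MeasurableSpace M] [BorelSpace M]
    (hf : IsLocalDiffeomorph (𝓡 d) (𝓡 d) 1 f) (hΛ : IsCompact Λ) (hinv : MapsTo f Λ Λ)
    (hS : IsContinuousSubbundle Λ S)
    (hmap : ∀ x ∈ Λ, (S x).map (mfderiv (𝓡 d) (𝓡 d) f x).toLinearMap = S (f x))
    {y : M} (hy : y ∈ Λ) (hV : invariantMeasures f Λ ⊆ accumulationMeasures f y)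
    (g g' : Metric d M) {i o : ℕ → ℕ} (hi : i 0 = 0) (ho : o 0 = 0)
    (hsub : ∀ x ∈ Λ, ∀ m n, relNorm (dlen g' f (i (m + n)) x) (dlen g' f (o (m + n)) x) (S x)
      ≤ relNorm (dlen g' f (i m) (f^[n] x)) (dlen g' f (o m) (f^[n] x)) (S (f^[n] x))
        * relNorm (dlen g' f (i n) x) (dlen g' f (o n) x) (S x))
    {η : ℝ} (hη : 0 < η) (L : ℕ)
    (hlim : limsup (fun k : ℕ => (((k : ℝ)⁻¹ : ℝ) : EReal) * ∑ j ∈ Finset.range k,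
      ENNReal.log (relNorm (dlen g' f (i L) (f^[j] y)) (dlen g' f (o L) (f^[j] y))
        (S (f^[j] y)))) atTop ≤ ((-η : ℝ) : EReal)) :
    ∃ C lam : ℝ, 0 < C ∧ 0 < lam ∧ lam < 1 ∧ ∀ n, ∀ x ∈ Λ,
      relNorm (dlen g f (i n) x) (dlen g f (o n) x) (S x) ≤ ENNReal.ofReal (C * lam ^ n) := by
  -- Metrizability lets closed sets be approximated from outside by continuous functions, as the
  -- weak-limit arguments require.
  have : SecondCountableTopology M :=
    ChartedSpace.secondCountable_of_sigmaCompact (EuclideanSpace ℝ (Fin d)) M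
  have : TopologicalSpace.MetrizableSpace M :=
    TopologicalSpace.metrizableSpace_of_t3_secondCountable M
  obtain ⟨φ, hφ, hφL, hφy⟩ := exists_log_relNorm_majorant hf hΛ hinv hS hmap g' (i L) (o L) hy hη
    hlim
  have hev := eventually_forall_birkhoffSum_le hf.contMDiff.continuous hΛ.isClosed hinv hy hV hφ
    (by linarith : -(η / 2) < -(η / 4)) hφy
  obtain ⟨D, hD1, hD⟩ := exists_relNorm_dlen_le hf g' g' (i 1) (o 1) hΛ hS
  have h0 : ∀ x ∈ Λ, relNorm (dlen g' f (i 0) x) (dlen g' f (o 0) x) (S x) ≤ 1 := fun x _ => by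
    rw [hi, ho]
    exact (relNorm_le_iff (isLength_dlen hf g' 0 x) (isLength_dlen hf g' 0 x)).2 (by simp)
  obtain ⟨m, hm, hhalf⟩ := exists_cocycle_le_half (L := L)
    (a := fun n x => relNorm (dlen g' f (i n) x) (dlen g' f (o n) x) (S x)) hinv h0 hsub hD1 hD hφL
    (by positivity : 0 < η / 4) hev
  obtain ⟨C, lam, hC, hlam, hlam1, hgeo⟩ := exists_cocycle_le_geometric
    (a := fun n x => relNorm (dlen g' f (i n) x) (dlen g' f (o n) x) (S x)) hinv h0 hsub hD1 hD hm
    hhalf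
  obtain ⟨K, hK1, hK⟩ := exists_relNorm_dlen_le hf g g' 0 0 hΛ hS
  obtain ⟨K', hK1', hK'⟩ := exists_relNorm_dlen_le hf g' g 0 0 hΛ hS
  refine ⟨K' * K * C, lam, by positivity, hlam, hlam1, fun n x hx => ?_⟩
  refine (relNorm_dlen_change_metric hf hinv hmap hK hK' (i n) (o n) hx).trans ?_
  rw [mul_assoc (K' * K), ENNReal.ofReal_mul (by positivity : 0 ≤ K' * K),
    ENNReal.ofReal_mul (by positivity : 0 ≤ K')]
  gcongr
  exact hgeo n x hx

end Hyperbolicity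

end HypSplit

theorem mainTheorem3 {d : ℕ} {M : Type*} [TopologicalSpace M] [T2Space M] [CompactSpace M]
    [ChartedSpace (EuclideanSpace ℝ (Fin d)) M] [IsManifold (𝓡 d) ∞ M]
    [MeasurableSpace M] [BorelSpace M]
    (g : HypSplit.Metric d M)
    (f : M → M) (hf : IsLocalDiffeomorph (𝓡 d) (𝓡 d) 1 f)
    (Λ : Set M) (hΛ : IsCompact Λ) (hinv : MapsTo f Λ Λ)
    (E F : ∀ x : M, Submodule ℝ (TangentSpace (𝓡 d) x))
    (hEF : HypSplit.IsContinuousInvariantSplitting f Λ E F)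
    (y : M) (hyΛ : y ∈ Λ) (hy : HypSplit.IsNUH f y E F)
    (hV : HypSplit.invariantMeasures f Λ = HypSplit.accumulationMeasures f y) :
    HypSplit.IsUniformlyHyperbolicWith g f Λ E F := by
  obtain ⟨-, η, L, g', hη, hE, hF⟩ := hy
  simp only [HypSplit.normOn_eq_relNorm] at hE
  simp only [HypSplit.invNormOn_eq_relNorm] at hF
  obtain ⟨C₁, l₁, hC₁, hl₁, hl₁', h₁⟩ := HypSplit.exists_relNorm_le_geometric hf hΛ hinv
    hEF.continuous_left hEF.map_left hyΛ hV.subset g g' (i := fun _ => 0) (o := id) rfl rfl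
    (fun x hx => HypSplit.normOn_add_le hf hinv hEF.map_left g' hx) hη L hE
  obtain ⟨C₂, l₂, hC₂, hl₂, hl₂', h₂⟩ := HypSplit.exists_relNorm_le_geometric hf hΛ hinv
    hEF.continuous_right hEF.map_right hyΛ hV.subset g g' (i := id) (o := fun _ => 0) rfl rfl
    (fun x hx => HypSplit.invNormOn_add_le hf hinv hEF.map_right g' hx) hη L hF
  refine ⟨hEF, max C₁ C₂, max l₁ l₂, lt_max_of_lt_left hC₁, lt_max_of_lt_left hl₁,
    max_lt hl₁' hl₂', fun n x hx => ⟨?_, ?_⟩⟩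
  · rw [HypSplit.normOn_eq_relNorm]
    refine (h₁ n x hx).trans (ENNReal.ofReal_le_ofReal ?_)
    gcongr
    exacts [le_max_left _ _, le_max_left _ _]
  · rw [HypSplit.invNormOn_eq_relNorm]
    refine (h₂ n x hx).trans (ENNReal.ofReal_le_ofReal ?_)
    gcongr
    exacts [le_max_right _ _, le_max_right _ _]
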